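/- All spaces are assumed to be $T_1$. A topological space is hereditarily normal if each of its subspaces is normal. A space $X$ has a $G_\delta$-diagonal if the diagonal $\{(x,x) : x\in X\}$ is the intersection of a countable family of open subsets of $X\times X$. A non-trivial convergent sequence is a space homeomorphic to the subspace $\{0\}\cup\{1/n : n=1,2,3,\dots\}$ of the real line; a space $X$ has a non-trivial convergent sequence if some subspace of $X$ is one. Theorem 2.10. Let $G$ be a hereditarily normal topological group. Then either 1. $G$ has a non-trivial convergent sequence and $G$ has a $G_\delta$-diagonal, or 2. $G$ has no non-trivial convergent sequence and every compact subset of $G$ is finite. In either case, every compact subset of $G$ is metrizable (in the subspace topology). -/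

import Mathlib

/-- The subset `{0} ∪ {1/n : n = 1, 2, 3, …}` of the real line. -/
def modelSequence : Set ℝ :=
  {0} ∪ {x : ℝ | ∃ n : ℕ, 1 ≤ n ∧ x = 1 / (n : ℝ)}

/-- `X` has a non-trivial convergent sequence: some subspace of `X` is homeomorphic to the
subspace `{0} ∪ {1/n : n = 1, 2, 3, …}` of the reals. -/
def HasNontrivialConvergentSequence (X : Type*) [TopologicalSpace X] : Prop :=
  ∃ Y : Set X, Nonempty (Y ≃ₜ modelSequence)

/-- `X` has a `G_δ`-diagonal: the diagonal of `X × X` is the intersection of a countable family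
of open subsets of `X × X`. -/
def HasGDeltaDiagonal (X : Type*) [TopologicalSpace X] : Prop :=
  IsGδ (Set.diagonal X)

/-- `X` is hereditarily normal: it is `T₁` and each of its subspaces is normal. -/
structure IsHereditarilyNormal (X : Type*) [TopologicalSpace X] : Prop where
  t1 : T1Space X
  normal_subspace : ∀ Y : Set X, NormalSpace Y

open Set Filter Topology Pointwise

section TopologicalGroup

variable {G : Type*} [Group G] [TopologicalSpace G] [IsTopologicalGroup G]

/-! Hereditary normality separates any two sets each disjoint from the closure of the other. If `1`
is a limit of a countable set `A` missing `1`, some closed `G_δ` subgroup `D` misses `A`; separating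
`A` from `D \ closure A` and translating yields countably many neighbourhoods of `1` whose
intersection lies in `closure A` (`exists_nhds_iInter_subset_closure_range`).

If `A` is a sequence converging to `1`, that intersection is `{1}`, which gives the `G_δ`-diagonal
and metrizable compacta. If `A` comes from an infinite compact set, a compact `G_δ` subgroup fits
inside the intersection and some sequence in `A` converges to it. Zorn's lemma shrinks that subgroup
to the trivial one, correcting the sequence into one that converges to `1`. -/

/-- Countably many neighbourhoods of `1` contain a closed subgroup which is the intersection of a
decreasing sequence of closed neighbourhoods of `1`. -/
theorem exists_subgroup_eq_iInter_closed_nhds (O : ℕ → Set G) (hO : ∀ k, O k ∈ 𝓝 (1 : G)) :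
    ∃ (D : Subgroup G) (W : ℕ → Set G), Antitone W ∧ W 0 = univ ∧ (∀ k, IsClosed (W k)) ∧
      (∀ k, W k ∈ 𝓝 (1 : G)) ∧ (∀ k, W (k + 1) ⊆ O k) ∧ (D : Set G) = ⋂ k, W k := by
  have key : ∀ U : Set G, U ∈ 𝓝 (1 : G) →
      ∃ V ∈ 𝓝 (1 : G), IsClosed V ∧ V⁻¹ = V ∧ V * V ⊆ U :=
    fun U hU => exists_closed_nhds_one_inv_eq_mul_subset hU
  choose! F hF1 hFc hFi hFm using key
  -- `W 0` is everything, so constraint `O k` first applies to `W (k + 1)`.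
  let W : ℕ → Set G := fun k => Nat.rec univ (fun k V => F (V ∩ O k)) k
  have hWs : ∀ k, W (k + 1) = F (W k ∩ O k) := fun k => rfl
  have hW1 : ∀ k, W k ∈ 𝓝 (1 : G) := by
    intro k
    induction k with
    | zero => exact univ_mem
    | succ k ih => rw [hWs]; exact hF1 _ (inter_mem ih (hO k))
  have hnb : ∀ k, W k ∩ O k ∈ 𝓝 (1 : G) := fun k => inter_mem (hW1 k) (hO k)
  have hmul : ∀ k, W (k + 1) * W (k + 1) ⊆ W k ∩ O k := fun k => hFm _ (hnb k)
  have hsub : ∀ k, W (k + 1) ⊆ W k ∩ O k := fun k y hy =>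
    hmul k ⟨y, hy, 1, mem_of_mem_nhds (hW1 (k + 1)), mul_one y⟩
  have hinv : ∀ k y, y ∈ W k → y⁻¹ ∈ W k := by
    rintro (_ | k) y hy
    · trivial
    · rw [hWs, ← hFi _ (hnb k)]
      simpa using hy
  refine ⟨⟨⟨⟨⋂ k, W k, ?_⟩, ?_⟩, ?_⟩, W, antitone_nat_of_succ_le fun k =>
    (hsub k).trans inter_subset_left, rfl, ?_, hW1, fun k => (hsub k).trans inter_subset_right, rfl⟩
  · intro a b ha hb
    rw [mem_iInter] at *
    exact fun k => (hmul k ⟨a, ha (k + 1), b, hb (k + 1), rfl⟩).1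
  · exact mem_iInter.2 fun k => mem_of_mem_nhds (hW1 k)
  · intro a ha
    have ha' := mem_iInter.1 ha
    exact mem_iInter.2 fun k => hinv k a (ha' k)
  · rintro (_ | k)
    · exact isClosed_univ
    · exact hFc _ (hnb k)

/-- In a completely normal group, if `1` is a limit of a countable set not containing `1`, then the
closure of that set contains a `G_δ` neighbourhood of `1` that misses the set. -/
theorem exists_nhds_iInter_subset_closure_range [T1Space G] [CompletelyNormalSpace G]
    {x : ℕ → G} (hx : ∀ n, x n ≠ 1) (hcl : (1 : G) ∈ closure (range x)) :
    ∃ O : ℕ → Set G, (∀ k, O k ∈ 𝓝 (1 : G)) ∧ (⋂ k, O k) ⊆ closure (range x) ∧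
      ∀ n, x n ∉ ⋂ k, O k := by
  obtain ⟨D, W, -, -, hWc, hW1, hWO, hD⟩ := exists_subgroup_eq_iInter_closed_nhds
    (fun k => {x k}ᶜ) (fun k => isOpen_compl_singleton.mem_nhds (hx k).symm)
  have hxD : ∀ n, x n ∉ D := fun n hn => by
    have : x n ∈ (D : Set G) := hn
    rw [hD, mem_iInter] at this
    exact hWO n (this (n + 1)) rfl
  have hDc : IsClosed (D : Set G) := hD ▸ isClosed_iInter hWc
  have hsep : Disjoint (𝓝ˢ (range x)) (𝓝ˢ ((D : Set G) \ closure (range x))) := by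
    refine CompletelyNormalSpace.completely_normal
      (disjoint_sdiff_right) (disjoint_left.2 ?_)
    rintro _ ⟨n, rfl⟩ hn
    exact hxD n (closure_minimal sdiff_subset hDc hn)
  obtain ⟨U, V, hU, hV, hxU, hDV, hUV⟩ := separatedNhds_iff_disjoint.2 hsep
  -- A common point `y` has `x k * y ∈ U` for all `k`; were `y` in `V`, some `x n` close to `1`
  -- would give `x n * y ∈ V`.
  refine ⟨fun k => W k ∩ (fun y => x k * y) ⁻¹' U, fun k => inter_mem (hW1 k) ?_, ?_, ?_⟩
  · refine (hU.preimage (continuous_const_mul (x k))).mem_nhds ?_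
    simpa using hxU (mem_range_self k)
  · intro y hy
    rw [mem_iInter] at hy
    have hyD : y ∈ (D : Set G) := hD ▸ mem_iInter.2 fun k => (hy k).1
    by_contra hyc
    have hVy : (fun g => g * y) ⁻¹' V ∈ 𝓝 (1 : G) :=
      (hV.preimage (continuous_mul_const y)).mem_nhds (by simpa using hDV ⟨hyD, hyc⟩)
    obtain ⟨_, hg, n, rfl⟩ := mem_closure_iff_nhds.1 hcl _ hVy
    exact disjoint_left.1 hUV (hy n).2 hg
  · intro n hn
    rw [mem_iInter] at hn
    refine hxD n ?_
    change x n ∈ (D : Set G)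
    exact hD ▸ mem_iInter.2 fun k => (hn k).1

/-- A sequence converging to a compact set `P` and eventually in each of a decreasing sequence of
closed sets converges to the intersection of all these sets. -/
theorem tendsto_nhdsSet_inter_iInter {X : Type*} [TopologicalSpace X] [T2Space X] {P : Set X}
    (hP : IsCompact P) {W : ℕ → Set X} (hW : Antitone W) (hWc : ∀ k, IsClosed (W k)) {x : ℕ → X}
    (hx : Tendsto x atTop (𝓝ˢ P)) (hxW : ∀ k, ∀ᶠ n in atTop, x n ∈ W k) :
    Tendsto x atTop (𝓝ˢ (P ∩ ⋂ k, W k)) := by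
  rw [(hasBasis_nhdsSet _).tendsto_right_iff]
  rintro U ⟨hU, hPU⟩
  obtain ⟨k, hk⟩ := exists_subset_nhds_of_isCompact (V := fun k => P ∩ W k)
    (directed_of_isDirected_le fun i j hij => inter_subset_inter_right P (hW hij))
    (fun k => hP.inter_right (hWc k)) (U := U)
    (fun y hy => hU.mem_nhds (hPU (by rwa [inter_iInter])))
  have hO : U ∪ (W k)ᶜ ∈ 𝓝ˢ P := (hU.union (hWc k).isOpen_compl).mem_nhdsSet.2 fun y hy => by
    by_cases hyk : y ∈ W k
    · exact Or.inl (hk ⟨hy, hyk⟩)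
    · exact Or.inr hyk
  filter_upwards [hx hO, hxW k] with n h1 h2
  exact h1.resolve_right fun h => h h2

/-- If a sequence converges to a compact subgroup, then so do its left cosets. -/
theorem tendsto_smul_smallSets_nhdsSet {H : Subgroup G} (hH : IsCompact (H : Set G)) {x : ℕ → G}
    (hx : Tendsto x atTop (𝓝ˢ (H : Set G))) :
    Tendsto (fun n => x n • (H : Set G)) atTop (𝓝ˢ (H : Set G)).smallSets := by
  rw [(hasBasis_nhdsSet _).smallSets.tendsto_right_iff]
  rintro U ⟨hU, hHU⟩
  -- The complement of `Uᶜ * H` consists of the points whose left coset of `H` lies in `U`.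
  have hcl : IsClosed (Uᶜ * (H : Set G)) := hU.isClosed_compl.mul_right_of_isCompact hH
  have hO : (Uᶜ * (H : Set G))ᶜ ∈ 𝓝ˢ (H : Set G) := by
    refine hcl.isOpen_compl.mem_nhdsSet.2 ?_
    rintro y hy ⟨u, hu, h, hh, rfl⟩
    exact hu (hHU ((H.mul_mem_cancel_right hh).1 hy))
  filter_upwards [hx hO] with n hn
  rintro _ ⟨h, hh, rfl⟩
  by_contra hU'
  exact hn ⟨x n • h, hU', h⁻¹, H.inv_mem hh, by simp⟩

/-- Cosets converging to a nontrivial compact subgroup contain cosets converging to a proper compact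
subgroup. -/
theorem exists_lt_tendsto_smallSets_nhdsSet [T2Space G] {H : Subgroup G}
    (hH : IsCompact (H : Set G)) (hne : H ≠ ⊥) {x : ℕ → G}
    (hx : Tendsto (fun n => x n • (H : Set G)) atTop (𝓝ˢ (H : Set G)).smallSets) :
    ∃ H' < H, IsCompact (H' : Set G) ∧ ∃ y : ℕ → G,
      (∀ n, y n • (H' : Set G) ⊆ x n • (H : Set G)) ∧
      Tendsto (fun n => y n • (H' : Set G)) atTop (𝓝ˢ (H' : Set G)).smallSets := by
  classical
  obtain ⟨a, haH, ha⟩ := H.bot_or_exists_ne_one.resolve_left hne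
  obtain ⟨D, W, hWa, hW0, hWc, hW1, hWO, hD⟩ := exists_subgroup_eq_iInter_closed_nhds
    (fun _ => {a}ᶜ) (fun _ => isOpen_compl_singleton.mem_nhds ha.symm)
  have haD : a ∉ D := fun h => by
    have : a ∈ (D : Set G) := h
    rw [hD, mem_iInter] at this
    exact hWO 0 (this 1) rfl
  have hcoe : ((H ⊓ D : Subgroup G) : Set G) = (H : Set G) ∩ ⋂ k, W k := by
    rw [Subgroup.coe_inf, hD]
  have hcpt : IsCompact ((H ⊓ D : Subgroup G) : Set G) :=
    hcoe ▸ hH.inter_right (isClosed_iInter hWc)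
  let p : ℕ → ℕ → Prop := fun n k => (x n • (H : Set G) ∩ W k).Nonempty
  -- The deepest `W k` met by the `n`th coset, capped at `n` so that a maximum exists; `k n` tends
  -- to infinity.
  let k : ℕ → ℕ := fun n => Nat.findGreatest (p n) n
  have hp : ∀ n, p n (k n) := fun n => by
    refine Nat.findGreatest_spec (m := 0) (Nat.zero_le n) ⟨x n, ?_, hW0 ▸ mem_univ _⟩
    exact ⟨1, H.one_mem, by simp⟩
  have hpev : ∀ j, ∀ᶠ n in atTop, p n j := by
    intro j
    have hO : interior (W j) * (H : Set G) ∈ 𝓝ˢ (H : Set G) := by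
      refine isOpen_interior.mul_right.mem_nhdsSet.2 fun h hh => ?_
      exact ⟨1, mem_interior_iff_mem_nhds.2 (hW1 j), h, hh, one_mul h⟩
    filter_upwards [tendsto_smallSets_iff.1 hx _ hO] with n hn
    obtain ⟨w, hw, h, hh, hwh⟩ := hn ⟨1, H.one_mem, rfl⟩
    refine ⟨w, ⟨h⁻¹, H.inv_mem hh, ?_⟩, interior_subset hw⟩
    simp only [smul_eq_mul, mul_one] at hwh ⊢
    rw [← hwh, mul_inv_cancel_right]
  choose y hyx hyW using hp
  refine ⟨H ⊓ D, lt_of_le_of_ne inf_le_left fun h => haD ((inf_eq_left.1 h) haH), hcpt, y, ?_, ?_⟩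
  · rintro n _ ⟨g, hg, rfl⟩
    obtain ⟨h, hh, hxy⟩ := hyx n
    refine ⟨h * g, H.mul_mem hh hg.1, ?_⟩
    simp only [smul_eq_mul] at hxy ⊢
    rw [← hxy, mul_assoc]
  · refine tendsto_smul_smallSets_nhdsSet hcpt ?_
    rw [hcoe]
    refine tendsto_nhdsSet_inter_iInter hH hWa hWc (fun U hU => ?_) fun j => ?_
    · exact (tendsto_smallSets_iff.1 hx _ hU).mono fun n hn => hn (hyx n)
    · filter_upwards [hpev j, eventually_ge_atTop j] with n hn hjn
      exact hWa (Nat.le_findGreatest hjn hn) (hyW n)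

/-- A sequence converging to a compact subgroup `H` can be corrected by elements of `H` to a
sequence converging to `1`. -/
theorem exists_tendsto_one_of_tendsto_nhdsSet [T2Space G] {H : Subgroup G}
    (hH : IsCompact (H : Set G)) {x : ℕ → G} (hx : Tendsto x atTop (𝓝ˢ (H : Set G))) :
    ∃ y : ℕ → G, (∀ n, y n ∈ x n • (H : Set G)) ∧ Tendsto y atTop (𝓝 1) := by
  -- The dual order turns minimal pairs (compact subgroup, cosets converging to it) into maximal
  -- ones.
  let S : Set (Subgroup G × (ℕ → Set G))ᵒᵈ := {q | IsCompact ((OrderDual.ofDual q).1 : Set G) ∧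
    (∀ n, ∃ z : G, (OrderDual.ofDual q).2 n = z • ((OrderDual.ofDual q).1 : Set G)) ∧
    Tendsto (OrderDual.ofDual q).2 atTop (𝓝ˢ ((OrderDual.ofDual q).1 : Set G)).smallSets}
  have hstart : OrderDual.toDual (H, fun n => x n • (H : Set G)) ∈ S :=
    ⟨hH, fun n => ⟨x n, rfl⟩, tendsto_smul_smallSets_nhdsSet hH hx⟩
  have hbdd : ∀ c ⊆ S, IsChain (· ≤ ·) c → ∀ q ∈ c, ∃ ub ∈ S, ∀ r ∈ c, r ≤ ub := by
    intro c hcS hchain q₀ hq₀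
    have : Nonempty c := ⟨⟨q₀, hq₀⟩⟩
    let K : c → Subgroup G := fun q => (OrderDual.ofDual q.1).1
    let C : c → ℕ → Set G := fun q => (OrderDual.ofDual q.1).2
    have hKc : ∀ q, IsCompact (K q : Set G) := fun q => (hcS q.2).1
    have hCK : ∀ q n, ∃ z : G, C q n = z • (K q : Set G) := fun q => (hcS q.2).2.1
    have hCt : ∀ q, Tendsto (C q) atTop (𝓝ˢ (K q : Set G)).smallSets := fun q => (hcS q.2).2.2
    have hCc : ∀ q n, IsCompact (C q n) := fun q n => by
      obtain ⟨z, hz⟩ := hCK q n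
      rw [hz]
      exact (hKc q).smul z
    have htot : ∀ q r : c, (K r ≤ K q ∧ C r ≤ C q) ∨ (K q ≤ K r ∧ C q ≤ C r) := fun q r => by
      rcases hchain.total q.2 r.2 with h | h
      · exact Or.inl ⟨h.1, h.2⟩
      · exact Or.inr ⟨h.1, h.2⟩
    have hKd : Directed (· ⊇ ·) fun q => (K q : Set G) := fun q r => by
      rcases htot q r with h | h
      · exact ⟨r, h.1, Subset.rfl⟩
      · exact ⟨q, Subset.rfl, h.1⟩
    have hCd : ∀ n, Directed (· ⊇ ·) fun q => C q n := fun n q r => by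
      rcases htot q r with h | h
      · exact ⟨r, h.2 n, Subset.rfl⟩
      · exact ⟨q, Subset.rfl, h.2 n⟩
    -- By compactness the nested `n`th cosets share a point `z n`, which represents all of them.
    have hne : ∀ n, (⋂ q, C q n).Nonempty := fun n => by
      refine IsCompact.nonempty_iInter_of_directed_nonempty_isCompact_isClosed _ (hCd n)
        (fun q => ?_) (fun q => hCc q n) (fun q => (hCc q n).isClosed)
      obtain ⟨z, hz⟩ := hCK q n
      exact ⟨z, hz ▸ ⟨1, (K q).one_mem, by simp⟩⟩
    choose z hz using hne
    have hzC : ∀ q n, C q n = z n • (K q : Set G) := fun q n => by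
      obtain ⟨w, hw⟩ := hCK q n
      have h1 : z n ∈ C q n := mem_iInter.1 (hz n) q
      rw [hw] at h1 ⊢
      obtain ⟨h, hh, he⟩ := h1
      rw [← he]
      simp only [smul_eq_mul]
      rw [← smul_smul, smul_coe_set hh]
    have hcoe : ((⨅ q, K q : Subgroup G) : Set G) = ⋂ q, (K q : Set G) := Subgroup.coe_iInf
    have hIc : IsCompact ((⨅ q, K q : Subgroup G) : Set G) := by
      rw [hcoe]
      exact (hKc ⟨q₀, hq₀⟩).of_isClosed_subset (isClosed_iInter fun q => (hKc q).isClosed)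
        (iInter_subset _ _)
    refine ⟨OrderDual.toDual (⨅ q, K q, fun n => z n • ((⨅ q, K q : Subgroup G) : Set G)),
      ⟨hIc, fun n => ⟨z n, rfl⟩, ?_⟩, ?_⟩
    · refine tendsto_smul_smallSets_nhdsSet hIc ?_
      rw [(hasBasis_nhdsSet _).tendsto_right_iff]
      rintro U ⟨hU, hKU⟩
      obtain ⟨q, hqU⟩ := exists_subset_nhds_of_isCompact hKd hKc (U := U)
        fun y hy => hU.mem_nhds (hKU (hcoe ▸ hy))
      filter_upwards [tendsto_smallSets_iff.1 (hCt q) U (hU.mem_nhdsSet.2 hqU)] with n hn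
      exact hn (mem_iInter.1 (hz n) q)
    · intro r hr
      refine ⟨(iInf_le K ⟨r, hr⟩ : (⨅ q, K q) ≤ K ⟨r, hr⟩), fun n => ?_⟩
      change z n • ((⨅ q, K q : Subgroup G) : Set G) ⊆ C ⟨r, hr⟩ n
      rw [hzC]
      exact smul_set_mono (iInf_le K ⟨r, hr⟩ : (⨅ q, K q) ≤ K ⟨r, hr⟩)
  obtain ⟨q, hq, ⟨hc, hz, ht⟩, hm⟩ := zorn_le_nonempty₀ S hbdd _ hstart
  obtain ⟨K, C, rfl⟩ : ∃ K C, q = OrderDual.toDual (K, C) := ⟨_, _, rfl⟩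
  change IsCompact (K : Set G) at hc
  change ∀ n, ∃ z : G, C n = z • (K : Set G) at hz
  change Tendsto C atTop (𝓝ˢ (K : Set G)).smallSets at ht
  choose z hz using hz
  obtain rfl : C = fun n => z n • (K : Set G) := funext hz
  by_cases hbot : K = ⊥
  · refine ⟨z, fun n => ?_, ?_⟩
    · have h2 : z n • (K : Set G) ⊆ x n • (H : Set G) := hq.2 n
      exact h2 ⟨1, K.one_mem, by simp⟩
    · intro U hU
      have hU' : U ∈ 𝓝ˢ (K : Set G) := by simpa [hbot] using hU
      exact (tendsto_smallSets_iff.1 ht U hU').mono fun n hn => hn ⟨1, K.one_mem, by simp⟩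
  · obtain ⟨K', hlt, hc', y, hy, ht'⟩ := exists_lt_tendsto_smallSets_nhdsSet hc hbot ht
    have hle := hm (y := OrderDual.toDual (K', fun n => y n • (K' : Set G)))
      ⟨hc', fun n => ⟨y n, rfl⟩, ht'⟩ ⟨hlt.le, hy⟩
    exact absurd (show K ≤ K' from hle.1) hlt.not_ge

/-- An infinite compact subset of a completely normal group yields a nontrivial sequence converging
to `1`. -/
theorem exists_tendsto_one_of_infinite_isCompact [T1Space G] [CompletelyNormalSpace G] {K : Set G}
    (hK : IsCompact K) (hinf : K.Infinite) :
    ∃ y : ℕ → G, (∀ n, y n ≠ 1) ∧ Tendsto y atTop (𝓝 1) := by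
  have : T5Space G := {}
  obtain ⟨N, hNK, hNinf, hNc⟩ : ∃ N ⊆ K, N.Infinite ∧ N.Countable := by
    obtain ⟨f, hf⟩ : ∃ f : ℕ → G, Function.Injective f ∧ ∀ n, f n ∈ K :=
      ⟨fun n => hinf.natEmbedding K n,
        Subtype.val_injective.comp (hinf.natEmbedding K).injective, fun n => (hinf.natEmbedding K n).2⟩
    exact ⟨range f, range_subset_iff.2 hf.2, infinite_range_of_injective hf.1, countable_range f⟩
  obtain ⟨p, -, hp⟩ := hNinf.exists_accPt_of_subset_isCompact hK hNK
  rw [accPt_principal_iff_clusterPt, ← mem_closure_iff_clusterPt] at hp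
  obtain ⟨w, hw⟩ := (hNc.mono sdiff_subset).exists_eq_range (closure_nonempty_iff.1 ⟨p, hp⟩)
  have hwN : ∀ n, w n ∈ N \ {p} := fun n => hw ▸ mem_range_self n
  let x : ℕ → G := fun n => p⁻¹ * w n
  have hx1 : ∀ n, x n ≠ 1 := fun n h => (hwN n).2 (inv_mul_eq_one.1 h).symm
  have hcl : (1 : G) ∈ closure (range x) := by
    have : range x = (fun g => p⁻¹ * g) '' range w := by rw [← range_comp]; rfl
    rw [this, ← hw, ← inv_mul_cancel p]
    exact image_closure_subset_closure_image (continuous_const_mul p⁻¹) ⟨p, hp, rfl⟩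
  have hcpt : IsCompact (closure (range x)) := by
    refine (hK.image (continuous_const_mul p⁻¹)).closure_of_subset ?_
    rintro _ ⟨n, rfl⟩
    exact ⟨w n, hNK (hwN n).1, rfl⟩
  obtain ⟨O, hO1, hOcl, hOx⟩ := exists_nhds_iInter_subset_closure_range hx1 hcl
  obtain ⟨D, W, hWa, -, hWc, hW1, hWO, hD⟩ := exists_subgroup_eq_iInter_closed_nhds O hO1
  have hDO : (D : Set G) ⊆ ⋂ k, O k := fun g hg => mem_iInter.2 fun k =>
    hWO k (mem_iInter.1 (hD ▸ hg : g ∈ ⋂ k, W k) (k + 1))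
  have hDeq : closure (range x) ∩ ⋂ k, W k = D := by
    rw [← hD]
    exact inter_eq_right.2 (hDO.trans hOcl)
  have hDc : IsCompact (D : Set G) := hDeq ▸ hcpt.inter_right (isClosed_iInter hWc)
  have hm : ∀ k, ∃ m, x m ∈ W k := fun k => by
    obtain ⟨_, hg, n, rfl⟩ := mem_closure_iff_nhds.1 hcl _ (hW1 k)
    exact ⟨n, hg⟩
  choose m hm using hm
  have ht : Tendsto (fun k => x (m k)) atTop (𝓝ˢ (D : Set G)) := by
    rw [← hDeq]
    refine tendsto_nhdsSet_inter_iInter hcpt hWa hWc (fun U hU => ?_) fun k => ?_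
    · refine (Eventually.of_forall fun k => ?_ : ∀ᶠ k in atTop, x (m k) ∈ U)
      exact subset_of_mem_nhdsSet hU (subset_closure ⟨m k, rfl⟩)
    · filter_upwards [eventually_ge_atTop k] with j hj using hWa hj (hm j)
  obtain ⟨y, hy, hyt⟩ := exists_tendsto_one_of_tendsto_nhdsSet hDc ht
  -- If `y n = 1`, the coset of `x (m n)` is `D` itself, but `D` misses the sequence.
  refine ⟨y, fun n hn => hOx (m n) (hDO ?_), hyt⟩
  obtain ⟨d, hd, hde⟩ := hy n
  replace hde : x (m n) * d = 1 := hde.trans hn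
  change x (m n) ∈ D
  rw [eq_inv_of_mul_eq_one_left hde]
  exact D.inv_mem hd

/-- A completely normal group with a nontrivial sequence converging to `1` has countable
pseudocharacter. -/
theorem exists_nhds_iInter_eq_one_of_tendsto [T1Space G] [CompletelyNormalSpace G] {x : ℕ → G}
    (hx : ∀ n, x n ≠ 1) (ht : Tendsto x atTop (𝓝 1)) :
    ∃ O : ℕ → Set G, (∀ k, O k ∈ 𝓝 (1 : G)) ∧ ⋂ k, O k = {1} := by
  have : T5Space G := {}
  obtain ⟨O, hO1, hOcl, hOx⟩ := exists_nhds_iInter_subset_closure_range hx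
    (mem_closure_of_tendsto ht (Eventually.of_forall mem_range_self))
  refine ⟨O, hO1, Subset.antisymm (fun g hg => ?_) ?_⟩
  · have hsub : closure (range x) ⊆ insert 1 (range x) :=
      closure_minimal (subset_insert _ _) ht.isCompact_insert_range.isClosed
    rcases hsub (hOcl hg) with h | ⟨n, rfl⟩
    · exact h
    · exact absurd hg (hOx n)
  · rintro _ rfl
    exact mem_iInter.2 fun k => mem_of_mem_nhds (hO1 k)

theorem isGδ_diagonal_of_iInter_nhds_eq_one {O : ℕ → Set G} (hO : ∀ k, O k ∈ 𝓝 (1 : G))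
    (hO1 : ⋂ k, O k = {1}) : IsGδ (diagonal G) := by
  have : diagonal G = ⋂ k, (fun q : G × G => q.1⁻¹ * q.2) ⁻¹' interior (O k) := by
    ext q
    rw [mem_diagonal_iff, mem_iInter]
    constructor
    · intro h k
      simpa [h] using mem_interior_iff_mem_nhds.2 (hO k)
    · intro h
      have h1 : q.1⁻¹ * q.2 ∈ ⋂ k, O k := mem_iInter.2 fun k => interior_subset (h k)
      rw [hO1] at h1
      exact inv_mul_eq_one.1 h1
  rw [this]
  exact .iInter_of_isOpen fun k => isOpen_interior.preimage (by fun_prop)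

/-- Compact subsets of a Hausdorff group of countable pseudocharacter are metrizable. -/
theorem metrizableSpace_of_isCompact_of_iInter_nhds_eq_one [T2Space G] {O : ℕ → Set G}
    (hO : ∀ k, O k ∈ 𝓝 (1 : G)) (hO1 : ⋂ k, O k = {1}) {K : Set G} (hK : IsCompact K) :
    TopologicalSpace.MetrizableSpace K := by
  obtain ⟨D, W, hWa, -, hWc, hW1, hWO, hD⟩ := exists_subgroup_eq_iInter_closed_nhds O hO
  have : CompactSpace K := isCompact_iff_compactSpace.1 hK
  let _ : UniformSpace K := uniformSpaceOfCompactR1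
  -- Closed neighbourhoods of the diagonal that shrink to it; by compactness they form a countable
  -- base of the uniformity.
  let E : ℕ → Set (K × K) := fun k => (fun q : K × K => (q.1 : G)⁻¹ * q.2) ⁻¹' W k
  have hcont : Continuous fun q : K × K => (q.1 : G)⁻¹ * q.2 := by fun_prop
  have hEdiag : ∀ q, q ∈ ⋂ k, E k → q ∈ diagonal K := fun q hq => by
    have h1 : (q.1 : G)⁻¹ * q.2 ∈ ⋂ k, O k := mem_iInter.2 fun k =>
      hWO k (mem_iInter.1 hq (k + 1))
    rw [hO1] at h1
    exact Subtype.ext (inv_mul_eq_one.1 h1)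
  have hbasis : (𝓝ˢ (diagonal K)).HasBasis (fun _ : ℕ => True) E := by
    refine ⟨fun U => ⟨fun hU => ?_, ?_⟩⟩
    · obtain ⟨V, hV, hdV, hVU⟩ := mem_nhdsSet_iff_exists.1 hU
      obtain ⟨k, hk⟩ := exists_subset_nhds_of_isCompact (V := E)
        (directed_of_isDirected_le fun i j hij => preimage_mono (hWa hij))
        (fun k => ((hWc k).preimage hcont).isCompact) (U := V)
        (fun q hq => hV.mem_nhds (hdV (hEdiag q hq)))
      exact ⟨k, trivial, hk.trans hVU⟩
    · rintro ⟨k, -, hk⟩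
      refine mem_of_superset ?_ hk
      refine mem_nhdsSet_iff_forall.2 fun q hq => hcont.continuousAt.preimage_mem_nhds ?_
      rw [mem_diagonal_iff] at hq
      simpa [hq] using hW1 k
  rw [nhdsSet_diagonal_eq_uniformity] at hbasis
  have : (uniformity K).IsCountablyGenerated := hbasis.isCountablyGenerated
  exact UniformSpace.metrizableSpace

end TopologicalGroup

section ConvergentSequence

variable {X : Type*} [TopologicalSpace X] [T2Space X]

/-- An injective sequence together with its limit is a copy of the one-point compactification
of `ℕ`. -/
theorem nonempty_homeomorph_insert_range {x : ℕ → X} {p : X} (hinj : Function.Injective x)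
    (hne : ∀ n, x n ≠ p) (ht : Tendsto x atTop (𝓝 p)) :
    Nonempty (OnePoint ℕ ≃ₜ (insert p (range x) : Set X)) := by
  let f : OnePoint ℕ → X := fun a => a.elim p x
  have hf : Continuous f := (OnePoint.continuous_iff_from_nat f).2 ht
  have hfi : Function.Injective f := by
    intro a b hab
    induction a using OnePoint.rec <;> induction b using OnePoint.rec
    · rfl
    · exact absurd hab.symm (hne _)
    · exact absurd hab (hne _)
    · exact congrArg _ (hinj hab)
  have hr : range f = insert p (range x) := by
    ext y
    constructor
    · rintro ⟨a, rfl⟩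
      induction a using OnePoint.rec
      · exact Or.inl rfl
      · exact Or.inr ⟨_, rfl⟩
    · rintro (rfl | ⟨n, rfl⟩)
      · exact ⟨OnePoint.infty, rfl⟩
      · exact ⟨(n : OnePoint ℕ), rfl⟩
  exact ⟨((hf.isClosedEmbedding hfi).isEmbedding.toHomeomorph).trans (.setCongr hr)⟩

theorem modelSequence_eq : modelSequence = insert 0 (range fun n : ℕ => 1 / ((n : ℝ) + 1)) := by
  ext y
  constructor
  · rintro (h | ⟨n, hn, rfl⟩)
    · exact Or.inl h
    · obtain ⟨m, rfl⟩ := Nat.exists_eq_add_of_le' hn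
      exact Or.inr ⟨m, by simp⟩
  · rintro (h | ⟨n, rfl⟩)
    · exact Or.inl h
    · exact Or.inr ⟨n + 1, by simp, by simp⟩

theorem nonempty_onePoint_homeomorph_modelSequence :
    Nonempty (OnePoint ℕ ≃ₜ modelSequence) := by
  rw [modelSequence_eq]
  refine nonempty_homeomorph_insert_range (fun a b h => ?_) (fun n => ?_)
    tendsto_one_div_add_atTop_nhds_zero_nat
  · simpa using h
  · positivity

/-- Allows sequences with repetitions: one that avoids its limit has infinite range, since a finite
range would be closed, and so can be made injective. -/
theorem hasNontrivialConvergentSequence_iff :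
    HasNontrivialConvergentSequence X ↔
      ∃ (x : ℕ → X) (p : X), (∀ n, x n ≠ p) ∧ Tendsto x atTop (𝓝 p) := by
  obtain ⟨e⟩ := nonempty_onePoint_homeomorph_modelSequence
  constructor
  · rintro ⟨Y, ⟨g⟩⟩
    let f : OnePoint ℕ → X := fun a => (g.symm (e a) : X)
    have hf : Continuous f := by fun_prop
    have hfi : Function.Injective f :=
      Subtype.val_injective.comp (g.symm.injective.comp e.injective)
    exact ⟨fun n => f n, f OnePoint.infty, fun n h => OnePoint.coe_ne_infty n (hfi h),
      (OnePoint.continuous_iff_from_nat f).1 hf⟩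
  · rintro ⟨x, p, hne, ht⟩
    have hinf : (range x).Infinite := fun hfin => by
      have hp : p ∈ closure (range x) :=
        mem_closure_of_tendsto ht (Eventually.of_forall mem_range_self)
      rw [hfin.isClosed.closure_eq] at hp
      obtain ⟨n, hn⟩ := hp
      exact hne n hn
    let y : ℕ → X := fun n => hinf.natEmbedding _ n
    have hyi : Function.Injective y :=
      Subtype.val_injective.comp (hinf.natEmbedding _).injective
    have hyx : ∀ n, y n ∈ range x := fun n => (hinf.natEmbedding _ n).2
    have hyt : Tendsto y atTop (𝓝 p) := by
      -- Along the cofinite filter, the order in which `y` enumerates points of the range is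
      -- irrelevant.
      rw [← Nat.cofinite_eq_atTop] at ht ⊢
      intro U hU
      have hfin : (x ⁻¹' Uᶜ).Finite := ht hU
      refine ((hfin.image x).preimage hyi.injOn).subset fun n hn => ?_
      obtain ⟨m, hm⟩ := hyx n
      refine ⟨m, ?_, hm⟩
      change x m ∉ U
      rw [hm]
      exact hn
    obtain ⟨g⟩ := nonempty_homeomorph_insert_range hyi
      (fun n h => by obtain ⟨m, hm⟩ := hyx n; exact hne m (hm.trans h)) hyt
    exact ⟨_, ⟨g.symm.trans e⟩⟩

end ConvergentSequence

theorem theorem2p10 (G : Type*) [Group G] [TopologicalSpace G] [IsTopologicalGroup G]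
    (hG : IsHereditarilyNormal G) :
    ((HasNontrivialConvergentSequence G ∧ HasGDeltaDiagonal G) ∨
      (¬ HasNontrivialConvergentSequence G ∧ ∀ K : Set G, IsCompact K → K.Finite)) ∧
    ∀ K : Set G, IsCompact K → TopologicalSpace.MetrizableSpace K := by
  have := hG.t1
  have : CompletelyNormalSpace G := .of_forall_normalSpace hG.normal_subspace
  have : T5Space G := {}
  by_cases h : HasNontrivialConvergentSequence G
  · obtain ⟨x, p, hne, ht⟩ := hasNontrivialConvergentSequence_iff.1 h
    have ht' : Tendsto (fun n => p⁻¹ * x n) atTop (𝓝 1) := by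
      simpa using ht.const_mul p⁻¹
    obtain ⟨O, hO, hO1⟩ := exists_nhds_iInter_eq_one_of_tendsto
      (fun n hn => hne n (inv_mul_eq_one.1 hn).symm) ht'
    exact ⟨Or.inl ⟨h, isGδ_diagonal_of_iInter_nhds_eq_one hO hO1⟩,
      fun K hK => metrizableSpace_of_isCompact_of_iInter_nhds_eq_one hO hO1 hK⟩
  · have hfin : ∀ K : Set G, IsCompact K → K.Finite := fun K hK => by
      by_contra hinf
      obtain ⟨y, hy, hyt⟩ := exists_tendsto_one_of_infinite_isCompact hK hinf
      exact h (hasNontrivialConvergentSequence_iff.2 ⟨y, 1, hy, hyt⟩)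
    refine ⟨Or.inr ⟨h, hfin⟩, fun K hK => ?_⟩
    have : Finite K := hfin K hK
    infer_instance
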